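/- Let $L$ be a finite bounded distributive lattice with $0\neq 1$, with implication $r_1\to r_2=\bigvee\{\ell\in L: r_1\wedge\ell\le r_2\}$. For a non-empty partially ordered set $(W,R)$ (an intuitionistic Kripke frame), the *intuitionistic power* of $L$ with respect to $(W,R)$ is the algebra $(L^W,\vee,\wedge,\to,0,1)$, where $L^W$ is the set of order-preserving (persistent) maps $W\to L$, the operations $\vee,\wedge,0,1$ are pointwise, and $$(f\to g)(w)=\bigwedge\{f(w')\to g(w') : wRw'\}.$$ Let $ISP_I(L)$ be the category whose objects are all isomorphic copies of subalgebras of intuitionistic powers of $L$, and whose arrows are the maps preserving $\vee,\wedge,\to,0,1$. Let $HSpa$ be the following category. An object is a non-empty compact topological space $S$ with a partial order $R$ such that (a) whenever $x\not\mathrel{R}y$, there is a clopen up-set $W\subseteq S$ with $x\in W$ and $y\notin W$; and (b) for every clopen $U\subseteq S$, the set $R^{-1}(U)=\{y\in S : yRx \text{ for some } x\in U\}$ is a clopen down-set. An arrow $(S_1,R_1)\to(S_2,R_2)$ is a continuous order-preserving map $\phi$ such that, whenever $\phi(s_1)R_2s_2$, there is $s\in S_1$ with $s_1R_1s$ and $\phi(s)=s_2$.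 **Theorem.** The category $ISP_I(L)$ is dually equivalent to the category $HSpa$; that is, $ISP_I(L)^{\mathrm{op}}$ and $HSpa$ are equivalent categories. -/

import Mathlib

open CategoryTheory

universe u v

/-! ### Algebras with operations `⊔, ⊓, ⇨, ⊤, ⊥` -/

/-- Algebras of the signature `(∨, ∧, →, 1, 0)`; no identities are required. -/
class ImpAlg (A : Type u) extends Max A, Min A, HImp A, Top A, Bot A

/-- Maps preserving all five operations. -/
@[ext]
structure ImpAlgHom (A : Type u) (B : Type v) [ImpAlg A] [ImpAlg B] where
  toFun : A → B
  map_sup : ∀ a b, toFun (a ⊔ b) = toFun a ⊔ toFun b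
  map_inf : ∀ a b, toFun (a ⊓ b) = toFun a ⊓ toFun b
  map_himp : ∀ a b, toFun (a ⇨ b) = toFun a ⇨ toFun b
  map_top : toFun ⊤ = ⊤
  map_bot : toFun ⊥ = ⊥

namespace ImpAlgHom

/-- The identity homomorphism. -/
def id (A : Type u) [ImpAlg A] : ImpAlgHom A A where
  toFun a := a
  map_sup _ _ := rfl
  map_inf _ _ := rfl
  map_himp _ _ := rfl
  map_top := rfl
  map_bot := rfl

/-- Composition of homomorphisms. -/
def comp {A B C : Type u} [ImpAlg A] [ImpAlg B] [ImpAlg C]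
    (g : ImpAlgHom B C) (f : ImpAlgHom A B) : ImpAlgHom A C where
  toFun a := g.toFun (f.toFun a)
  map_sup a b := by rw [f.map_sup, g.map_sup]
  map_inf a b := by rw [f.map_inf, g.map_inf]
  map_himp a b := by rw [f.map_himp, g.map_himp]
  map_top := by rw [f.map_top, g.map_top]
  map_bot := by rw [f.map_bot, g.map_bot]

end ImpAlgHom

/-- Subalgebras: subsets closed under all five operations. -/
structure ImpSubalg (A : Type u) [ImpAlg A] where
  carrier : Set A
  sup_mem : ∀ {a b}, a ∈ carrier → b ∈ carrier → a ⊔ b ∈ carrier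
  inf_mem : ∀ {a b}, a ∈ carrier → b ∈ carrier → a ⊓ b ∈ carrier
  himp_mem : ∀ {a b}, a ∈ carrier → b ∈ carrier → a ⇨ b ∈ carrier
  top_mem : ⊤ ∈ carrier
  bot_mem : ⊥ ∈ carrier

/-- A subalgebra with the restricted operations. -/
instance ImpSubalg.instImpAlg {A : Type u} [ImpAlg A] (B : ImpSubalg A) :
    ImpAlg B.carrier where
  max a b := ⟨a.1 ⊔ b.1, B.sup_mem a.2 b.2⟩
  min a b := ⟨a.1 ⊓ b.1, B.inf_mem a.2 b.2⟩
  himp a b := ⟨a.1 ⇨ b.1, B.himp_mem a.2 b.2⟩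
  top := ⟨⊤, B.top_mem⟩
  bot := ⟨⊥, B.bot_mem⟩

/-! ### Intuitionistic powers -/

section FiniteLattice

variable {L : Type v} [DistribLattice L] [BoundedOrder L] [Finite L]

/-- The join of a subset of the finite lattice `L`. -/
noncomputable def finJoin (s : Set L) : L := s.toFinite.toFinset.sup (fun l => l)

/-- The meet of a subset of the finite lattice `L`. -/
noncomputable def finMeet (s : Set L) : L := s.toFinite.toFinset.inf (fun l => l)

theorem isLUB_finJoin (s : Set L) : IsLUB s (finJoin s) := by
  constructor
  · intro l hl
    exact Finset.le_sup (f := fun l : L => l) (s.toFinite.mem_toFinset.2 hl)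
  · intro b hb
    exact Finset.sup_le fun l hl => hb (s.toFinite.mem_toFinset.1 hl)

theorem isGLB_finMeet (s : Set L) : IsGLB s (finMeet s) := by
  constructor
  · intro l hl
    exact Finset.inf_le (f := fun l : L => l) (s.toFinite.mem_toFinset.2 hl)
  · intro b hb
    exact Finset.le_inf fun l hl => hb (s.toFinite.mem_toFinset.1 hl)

/-- The implication of `L`: the join of all `l` with `r₁ ∧ l ≤ r₂`. -/
noncomputable def finImp (r₁ r₂ : L) : L := finJoin {l | r₁ ⊓ l ≤ r₂}

end FiniteLattice

/-- The underlying set of the intuitionistic power of `L` with respect to the intuitionistic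
Kripke frame `(W, ≤)`: the persistent (that is, order preserving) valuations `W → L`. -/
structure IntPower (L : Type v) (W : Type u) [Preorder L] [PartialOrder W] where
  val : W → L
  mono : Monotone val

/-- The operations of the intuitionistic power: `∨, ∧, 1, 0` are pointwise, and
`(f → g)(w) = ⋀ {f w' → g w' | w ≤ w'}`. -/
noncomputable instance IntPower.instImpAlg (L : Type v) (W : Type u) [DistribLattice L]
    [BoundedOrder L] [Finite L] [PartialOrder W] : ImpAlg (IntPower L W) where
  max f g := ⟨fun w => f.val w ⊔ g.val w, fun _ _ h => sup_le_sup (f.mono h) (g.mono h)⟩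
  min f g := ⟨fun w => f.val w ⊓ g.val w, fun _ _ h => inf_le_inf (f.mono h) (g.mono h)⟩
  himp f g :=
    ⟨fun w => finMeet {l | ∃ w', w ≤ w' ∧ l = finImp (f.val w') (g.val w')}, by
      intro w₁ w₂ h
      refine (isGLB_finMeet _).2 ?_
      rintro l ⟨w', hw', rfl⟩
      exact (isGLB_finMeet _).1 ⟨w', h.trans hw', rfl⟩⟩
  top := ⟨fun _ => ⊤, fun _ _ _ => le_rfl⟩
  bot := ⟨fun _ => ⊥, fun _ _ _ => le_rfl⟩

/-! ### The category of algebras in `ISP_I(L)` -/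

/-- `A` is an isomorphic copy of a subalgebra of an intuitionistic power of `L`; the frame of an
intuitionistic power is a non-empty poset. -/
def IsISPI (L : Type v) [DistribLattice L] [BoundedOrder L] [Finite L]
    (A : Type u) [ImpAlg A] : Prop :=
  ∃ (W : Type u) (_ : PartialOrder W) (_ : Nonempty W) (B : ImpSubalg (IntPower L W))
    (e : ImpAlgHom A B.carrier), Function.Bijective e.toFun

/-- Objects of the category `ISP_I(L)`. -/
structure ISPI (L : Type v) [DistribLattice L] [BoundedOrder L] [Finite L] where
  carrier : Type u
  [alg : ImpAlg carrier]
  isISPI : IsISPI L carrier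

attribute [instance] ISPI.alg

/-- Arrows of `ISP_I(L)` are the maps preserving `∨, ∧, →, 1, 0`. -/
instance ISPI.instCategory (L : Type v) [DistribLattice L] [BoundedOrder L] [Finite L] :
    Category.{u} (ISPI.{u, v} L) where
  Hom A B := ImpAlgHom A.carrier B.carrier
  id A := ImpAlgHom.id A.carrier
  comp f g := ImpAlgHom.comp g f

/-! ### The category `HSpa` -/

/-- Objects of `PSpa`: (non-empty) compact spaces with a partial order such that `¬ x ≤ y`
implies that some clopen up-set contains `x` but not `y`. -/
structure PSpa where
  carrier : Type u
  [top : TopologicalSpace carrier]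
  [order : PartialOrder carrier]
  nonempty : Nonempty carrier
  compact : CompactSpace carrier
  separated : ∀ x y : carrier, ¬ x ≤ y →
    ∃ U : Set carrier, IsClopen U ∧ IsUpperSet U ∧ x ∈ U ∧ y ∉ U

attribute [instance] PSpa.top PSpa.order

/-- Objects of `HSpa`: objects of `PSpa` in which `R⁻¹(U) = {y | ∃ x ∈ U, y ≤ x}` is a clopen
down-set for every clopen `U`. -/
structure HSpa extends PSpa.{u} where
  clopen_down : ∀ U : Set carrier, IsClopen U →
    IsClopen {y | ∃ x ∈ U, y ≤ x} ∧ IsLowerSet {y | ∃ x ∈ U, y ≤ x}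

/-- Arrows `φ` of `HSpa` are the continuous order preserving maps such that `φ s₁ ≤ s₂` implies
`φ s = s₂` for some `s ≥ s₁`. -/
instance HSpa.instCategory : Category.{u} HSpa.{u} where
  Hom S T := EsakiaHom S.carrier T.carrier
  id S := EsakiaHom.id S.carrier
  comp f g := EsakiaHom.comp g f

/-! Up to isomorphism `L` plays no role: the objects of `ISP_I(L)` are exactly the nontrivial
Heyting algebras, and the theorem is Esakia duality. An intuitionistic power is a Heyting algebra,
and its subalgebras inherit this (`IsISPI.exists_heytingAlgebra`). Conversely, the clopen up-sets of
an Esakia space embed, as `{⊥, ⊤}`-valued characteristic functions, into the power over that same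
space regarded as a frame (`HSpa.isISPI_clopenUpperSet`).

The equivalence is given by the functor of clopen up-sets. It is faithful because clopen up-sets
separate points. It is full because, by compactness, each prime filter of clopen up-sets is that of
a point (`PSpa.exists_mem_iff`), so a homomorphism induces a map of points. It is essentially
surjective because a Heyting algebra is represented on its prime spectrum: the prime ideal theorem
gives injectivity and the formula for `⇨` (`PrimePoint.mem_himp_iff`), and compactness gives
surjectivity. -/

open Set Topology

/-! ### Algebras in `ISP_I(L)` are nontrivial Heyting algebras -/

/-- The underlying algebra of a Heyting algebra. -/
@[reducible]
def HeytingAlgebra.toImpAlg {A : Type u} (h : HeytingAlgebra A) : ImpAlg A where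
  max := h.sup
  min := h.inf
  himp := h.himp
  top := h.top
  bot := h.bot

/-- By distributivity, the join of all `l` with `a ⊓ l ≤ b` again satisfies this inequality. -/
theorem le_finImp_iff {L : Type v} [DistribLattice L] [BoundedOrder L] [Finite L] {a b c : L} :
    c ≤ finImp a b ↔ a ⊓ c ≤ b := by
  constructor
  · intro h
    refine (inf_le_inf_left a h).trans ?_
    rw [finImp, finJoin, Finset.sup_inf_distrib_left]
    exact Finset.sup_le fun l hl => (Set.Finite.mem_toFinset (s := {l | a ⊓ l ≤ b}) _).1 hl
  · exact fun h => (isLUB_finJoin _).1 h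

namespace IntPower

theorem val_injective {L : Type v} {W : Type u} [Preorder L] [PartialOrder W] :
    Function.Injective (val : IntPower L W → W → L) := by
  rintro ⟨_, _⟩ ⟨_, _⟩ rfl
  rfl

variable {L : Type v} {W : Type u} [DistribLattice L] [BoundedOrder L] [Finite L] [PartialOrder W]

/-- One direction evaluates the meet at `w' = w`; the other needs persistence of `f` to pass from
`w` to `w'`. -/
theorem le_himp_val_iff (f g h : IntPower L W) :
    f.val ≤ (g ⇨ h).val ↔ f.val ⊓ g.val ≤ h.val := by
  constructor
  · intro H w
    have h1 : (g ⇨ h).val w ≤ finImp (g.val w) (h.val w) :=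
      (isGLB_finMeet _).1 ⟨w, le_rfl, rfl⟩
    have h2 := le_finImp_iff.1 ((H w).trans h1)
    rwa [inf_comm] at h2
  · intro H w
    refine (isGLB_finMeet _).2 ?_
    rintro l ⟨w', hw, rfl⟩
    refine le_finImp_iff.2 ?_
    rw [inf_comm]
    exact (inf_le_inf_right _ (f.mono hw)).trans (H w')

/-- The intuitionistic power is a Heyting algebra for the pointwise order. -/
noncomputable instance instHeytingAlgebra : HeytingAlgebra (IntPower L W) where
  __ := PartialOrder.lift (val : IntPower L W → W → L) val_injective
  __ := IntPower.instImpAlg L W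
  sup f g := f ⊔ g
  inf f g := f ⊓ g
  le_sup_left f _ w := le_sup_left (a := f.val w)
  le_sup_right f _ w := le_sup_right (a := f.val w)
  sup_le _ _ _ h1 h2 w := sup_le (h1 w) (h2 w)
  inf_le_left f _ w := inf_le_left (a := f.val w)
  inf_le_right f _ w := inf_le_right (a := f.val w)
  le_inf _ _ _ h1 h2 w := le_inf (h1 w) (h2 w)
  le_top f w := le_top (a := f.val w)
  bot_le f w := bot_le (a := f.val w)
  le_himp_iff f g h := le_himp_val_iff f g h
  compl f := f ⇨ ⊥
  himp_bot _ := rfl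

end IntPower

/-- The Heyting structure is pulled back along the embedding into the power. Nontriviality comes
from evaluating at a point of the non-empty frame. -/
theorem IsISPI.exists_heytingAlgebra {L : Type v} [DistribLattice L] [BoundedOrder L] [Finite L]
    [Nontrivial L] {A : Type u} {alg : ImpAlg A} (hA : IsISPI L A) :
    ∃ h : HeytingAlgebra A, h.toImpAlg = alg ∧ Nontrivial A := by
  obtain ⟨W, _, ⟨w⟩, B, e, he⟩ := hA
  let f : A → IntPower L W := fun a => (e.toFun a).1
  have hf : Function.Injective f := Subtype.val_injective.comp he.1
  let : LE A := ⟨fun a b => f a ≤ f b⟩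
  let : LT A := ⟨fun a b => f a < f b⟩
  let : Compl A := ⟨fun a => a ⇨ ⊥⟩
  have hbot : f ⊥ = ⊥ := congrArg Subtype.val e.map_bot
  have htop : f ⊤ = ⊤ := congrArg Subtype.val e.map_top
  have himp : ∀ a b, f (a ⇨ b) = f a ⇨ f b := fun a b => congrArg Subtype.val (e.map_himp a b)
  refine ⟨hf.heytingAlgebra f Iff.rfl Iff.rfl (fun a b => congrArg Subtype.val (e.map_sup a b))
    (fun a b => congrArg Subtype.val (e.map_inf a b)) htop hbot
    (fun a => (himp a ⊥).trans (by rw [hbot, himp_bot])) himp, rfl, ⊤, ⊥, fun h => ?_⟩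
  have h1 : (⊤ : IntPower L W) = ⊥ := by rw [← htop, ← hbot, h]
  exact top_ne_bot (congrFun (congrArg IntPower.val h1) w : (⊤ : L) = ⊥)

/-! ### Separation in compact ordered spaces -/

namespace PSpa

variable {S T : PSpa.{u}}

/-- The differences of clopen upper sets form a basis. -/
theorem exists_clopenUpperSet_diff_subset {O : Set S.carrier} (hO : IsOpen O) {t : S.carrier}
    (ht : t ∈ O) : ∃ U V : ClopenUpperSet S.carrier, t ∈ U ∧ t ∉ V ∧ ∀ y ∈ U, y ∉ V → y ∈ O := by
  have := S.compact
  obtain ⟨U, V, hU, hV, h⟩ : ∃ U V : ClopenUpperSet S.carrier, t ∈ U ∧ t ∉ V ∧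
      ∀ y ∈ Oᶜ, y ∈ U → y ∈ V := by
    -- Local pairs `(U, V)` around points of `Oᶜ` are glued by meets of the `U` and joins of the
    -- `V`. Near `y ∈ Oᶜ` one of the two is trivial, according to whether `t ≤ y`.
    refine hO.isClosed_compl.isCompact.induction_on (p := fun K => ∃ U V : ClopenUpperSet S.carrier,
      t ∈ U ∧ t ∉ V ∧ ∀ y ∈ K, y ∈ U → y ∈ V) ?_ ?_ ?_ ?_
    · exact ⟨⊤, ⊥, trivial, id, fun y hy => hy.elim⟩
    · rintro K K' hK ⟨U, V, hU, hV, h⟩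
      exact ⟨U, V, hU, hV, fun y hy => h y (hK hy)⟩
    · rintro K K' ⟨U, V, hU, hV, h⟩ ⟨U', V', hU', hV', h'⟩
      refine ⟨U ⊓ U', V ⊔ V', ⟨hU, hU'⟩, fun hn => hn.elim hV hV', ?_⟩
      rintro y (hy | hy) hyU
      · exact Or.inl (h y hy hyU.1)
      · exact Or.inr (h' y hy hyU.2)
    · intro y hy
      by_cases hty : t ≤ y
      · have hyt : ¬ y ≤ t := fun hyt => hy (le_antisymm hty hyt ▸ ht)
        obtain ⟨V, hV, hVu, hyV, htV⟩ := S.separated y t hyt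
        exact ⟨V, mem_nhdsWithin_of_mem_nhds (hV.isOpen.mem_nhds hyV), ⊤, ⟨⟨V, hV⟩, hVu⟩,
          trivial, htV, fun z hz _ => hz⟩
      · obtain ⟨U, hU, hUu, htU, hyU⟩ := S.separated t y hty
        exact ⟨Uᶜ, mem_nhdsWithin_of_mem_nhds (hU.compl.isOpen.mem_nhds hyU), ⟨⟨U, hU⟩, hUu⟩, ⊥,
          htU, id, fun z hz hz' => hz hz'⟩
  exact ⟨U, V, hU, hV, fun y hyU hyV => by_contra fun hyO => hyV (h y hyO hyU)⟩

theorem le_of_forall_clopenUpperSet {x y : S.carrier}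
    (h : ∀ U : ClopenUpperSet S.carrier, x ∈ U → y ∈ U) : x ≤ y := by
  by_contra hxy
  obtain ⟨U, hU, hUu, hx, hy⟩ := S.separated x y hxy
  exact hy (h ⟨⟨U, hU⟩, hUu⟩ hx)

theorem t2Space (S : PSpa.{u}) : T2Space S.carrier := by
  refine ⟨fun x y hxy => ?_⟩
  by_cases h : x ≤ y
  · obtain ⟨U, hU, -, hyU, hxU⟩ := S.separated y x fun h' => hxy (le_antisymm h h')
    exact ⟨Uᶜ, U, hU.compl.isOpen, hU.isOpen, hxU, hyU, disjoint_compl_left⟩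
  · obtain ⟨U, hU, -, hxU, hyU⟩ := S.separated x y h
    exact ⟨U, Uᶜ, hU.isOpen, hU.compl.isOpen, hxU, hyU, disjoint_compl_right⟩

theorem isClosed_Ici (s : S.carrier) : IsClosed (Set.Ici s) := by
  have h : Set.Ici s = ⋂ U : {U : ClopenUpperSet S.carrier // s ∈ U}, (U.1 : Set S.carrier) := by
    ext y
    simp only [Set.mem_Ici, Set.mem_iInter]
    exact ⟨fun hy U => U.1.upper hy U.2, fun hy =>
      le_of_forall_clopenUpperSet fun U hU => hy ⟨U, hU⟩⟩
  rw [h]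
  exact isClosed_iInter fun U => U.1.isClopen.isClosed

/-- Every prime filter of clopen upper sets is the filter of those containing some point. -/
theorem exists_mem_iff (P : ClopenUpperSet S.carrier → Prop) (htop : P ⊤) (hbot : ¬ P ⊥)
    (hinf : ∀ U V, P (U ⊓ V) ↔ P U ∧ P V) (hsup : ∀ U V, P (U ⊔ V) ↔ P U ∨ P V) :
    ∃ t : S.carrier, ∀ U, t ∈ U ↔ P U := by
  have := S.compact
  by_contra! H
  -- If every point disagrees with `P` on some clopen up-set, compactness glues these disagreements
  -- into `U ⊆ V` with `P U` but not `P V`, contradicting monotonicity of `P`.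
  obtain ⟨U, V, hU, hV, h⟩ : ∃ U V : ClopenUpperSet S.carrier, P U ∧ ¬ P V ∧
      ∀ y ∈ (univ : Set S.carrier), y ∈ U → y ∈ V := by
    refine isCompact_univ.induction_on (p := fun K => ∃ U V : ClopenUpperSet S.carrier,
      P U ∧ ¬ P V ∧ ∀ y ∈ K, y ∈ U → y ∈ V) ?_ ?_ ?_ ?_
    · exact ⟨⊤, ⊥, htop, hbot, fun y hy => hy.elim⟩
    · rintro K K' hK ⟨U, V, hU, hV, h⟩
      exact ⟨U, V, hU, hV, fun y hy => h y (hK hy)⟩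
    · rintro K K' ⟨U, V, hU, hV, h⟩ ⟨U', V', hU', hV', h'⟩
      refine ⟨U ⊓ U', V ⊔ V', (hinf _ _).2 ⟨hU, hU'⟩,
        fun hn => ((hsup _ _).1 hn).elim hV hV', ?_⟩
      rintro y (hy | hy) hyU
      · exact Or.inl (h y hy hyU.1)
      · exact Or.inr (h' y hy hyU.2)
    · intro y _
      obtain ⟨U, ⟨hy, hP⟩ | ⟨hy, hP⟩⟩ := H y
      · exact ⟨U, mem_nhdsWithin_of_mem_nhds (U.isClopen.isOpen.mem_nhds hy), ⊤, U, htop, hP,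
          fun z hz _ => hz⟩
      · exact ⟨(U : Set S.carrier)ᶜ,
          mem_nhdsWithin_of_mem_nhds (U.isClopen.compl.isOpen.mem_nhds hy), U, ⊥, hP, hbot,
          fun z hz hz' => hz hz'⟩
  have hUV : U ⊓ V = U := by
    ext y
    exact ⟨fun hy => hy.1, fun hy => ⟨hy, h y trivial hy⟩⟩
  exact hV ((hinf U V).1 (hUV.symm ▸ hU)).2

theorem continuous_of_preimage_clopenUpperSet (f : S.carrier → T.carrier)
    (h : ∀ U : ClopenUpperSet T.carrier, IsClopen (f ⁻¹' U)) : Continuous f := by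
  refine continuous_def.2 fun O hO => isOpen_iff_mem_nhds.2 fun s hs => ?_
  obtain ⟨U, V, hU, hV, hUV⟩ := exists_clopenUpperSet_diff_subset hO hs
  exact Filter.mem_of_superset
    (((h U).diff (h V)).isOpen.mem_nhds (⟨hU, hV⟩ : s ∈ f ⁻¹' U \ f ⁻¹' V))
    fun y hy => hUV _ hy.1 hy.2

/-- A family of clopen upper sets, closed under finite meets and joins, that separates points in
the order contains every clopen upper set. -/
theorem surjective_of_separates {A : Type*} [Lattice A] [BoundedOrder A]
    (φ : A → ClopenUpperSet S.carrier) (htop : φ ⊤ = ⊤) (hbot : φ ⊥ = ⊥)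
    (hinf : ∀ a b, φ (a ⊓ b) = φ a ⊓ φ b) (hsup : ∀ a b, φ (a ⊔ b) = φ a ⊔ φ b)
    (hsep : ∀ x y : S.carrier, ¬ x ≤ y → ∃ a, x ∈ φ a ∧ y ∉ φ a) : Function.Surjective φ := by
  have := S.compact
  intro U
  -- Compactness is used twice: on the complement of `U`, taking finite meets for a fixed `x`, and
  -- then on `U`, taking finite joins.
  have key : ∀ x ∈ U, ∃ a, x ∈ φ a ∧ ∀ y ∈ (U : Set S.carrier)ᶜ, y ∉ φ a := by
    intro x hx
    refine U.isClopen.compl.isClosed.isCompact.induction_on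
      (p := fun K => ∃ a, x ∈ φ a ∧ ∀ y ∈ K, y ∉ φ a) ?_ ?_ ?_ ?_
    · exact ⟨⊤, by rw [htop]; trivial, fun y hy => hy.elim⟩
    · rintro K K' hK ⟨a, ha, h⟩
      exact ⟨a, ha, fun y hy => h y (hK hy)⟩
    · rintro K K' ⟨a, ha, h⟩ ⟨b, hb, h'⟩
      refine ⟨a ⊓ b, by rw [hinf]; exact ⟨ha, hb⟩, ?_⟩
      rw [hinf]
      rintro y (hy | hy) hab
      · exact h y hy hab.1
      · exact h' y hy hab.2
    · intro y hy
      obtain ⟨a, hxa, hya⟩ := hsep x y fun hxy => hy (U.upper hxy hx)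
      exact ⟨_, mem_nhdsWithin_of_mem_nhds ((φ a).isClopen.compl.isOpen.mem_nhds hya), a, hxa,
        fun z hz => hz⟩
  obtain ⟨a, haU, hUa⟩ : ∃ a, (∀ y ∈ φ a, y ∈ U) ∧ ∀ y ∈ (U : Set S.carrier), y ∈ φ a := by
    refine U.isClopen.isClosed.isCompact.induction_on
      (p := fun K => ∃ a, (∀ y ∈ φ a, y ∈ U) ∧ ∀ y ∈ K, y ∈ φ a) ?_ ?_ ?_ ?_
    · exact ⟨⊥, by rw [hbot]; exact fun y hy => hy.elim, fun y hy => hy.elim⟩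
    · rintro K K' hK ⟨a, ha, h⟩
      exact ⟨a, ha, fun y hy => h y (hK hy)⟩
    · rintro K K' ⟨a, ha, h⟩ ⟨b, hb, h'⟩
      refine ⟨a ⊔ b, ?_, ?_⟩
      · rw [hsup]
        exact fun y hy => hy.elim (ha y) (hb y)
      · rw [hsup]
        exact fun y hy => hy.elim (fun hy => Or.inl (h y hy)) fun hy => Or.inr (h' y hy)
    · intro x hx
      obtain ⟨a, hxa, ha⟩ := key x hx
      exact ⟨_, mem_nhdsWithin_of_mem_nhds ((φ a).isClopen.isOpen.mem_nhds hxa), a,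
        fun y hy => by_contra fun hyU => ha y hyU hy, fun z hz => hz⟩
  refine ⟨a, ?_⟩
  ext y
  exact ⟨haU y, hUa y⟩

/-- Condition (b) needs to be checked on differences of clopen upper sets only. -/
theorem isClopen_down_of_diff
    (h : ∀ U V : ClopenUpperSet S.carrier, IsClopen {y | ∃ x, (x ∈ U ∧ x ∉ V) ∧ y ≤ x})
    {O : Set S.carrier} (hO : IsClopen O) : IsClopen {y | ∃ x ∈ O, y ≤ x} := by
  have := S.compact
  -- `O` is a finite union of differences of clopen up-sets, and down-closure commutes with unions.
  -- Keeping `C ⊆ O` throughout forces `C = O` at the end.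
  obtain ⟨C, hCO, hOC, hC⟩ : ∃ C : Set S.carrier, C ⊆ O ∧ O ⊆ C ∧
      IsClopen {y | ∃ x ∈ C, y ≤ x} := by
    refine hO.isClosed.isCompact.induction_on
      (p := fun K => ∃ C : Set S.carrier, C ⊆ O ∧ K ⊆ C ∧ IsClopen {y | ∃ x ∈ C, y ≤ x})
      ?_ ?_ ?_ ?_
    · exact ⟨∅, empty_subset _, Subset.rfl, by simp [isClopen_empty]⟩
    · rintro K K' hK ⟨C, h1, h2, h3⟩
      exact ⟨C, h1, hK.trans h2, h3⟩
    · rintro K K' ⟨C, h1, h2, h3⟩ ⟨C', h1', h2', h3'⟩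
      refine ⟨C ∪ C', union_subset h1 h1', union_subset_union h2 h2', ?_⟩
      convert h3.union h3' using 1
      ext y
      simp only [mem_union, mem_ofPred_eq, or_and_right, exists_or]
    · intro x hx
      obtain ⟨U, V, hU, hV, hUV⟩ := exists_clopenUpperSet_diff_subset hO.isOpen hx
      exact ⟨_, mem_nhdsWithin_of_mem_nhds
        ((U.isClopen.diff V.isClopen).isOpen.mem_nhds (⟨hU, hV⟩ : x ∈ (U : Set S.carrier) \ V)),
        _, fun y hy => hUV y hy.1 hy.2, Subset.rfl, h U V⟩
  rwa [hCO.antisymm hOC] at hC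

end PSpa

/-! ### The algebra of clopen upper sets -/

namespace HSpa

variable {S T : HSpa.{u}}

/-- The implication of clopen upper sets of an Esakia space. -/
def himp (U V : ClopenUpperSet S.carrier) : ClopenUpperSet S.carrier where
  carrier := {x | ∀ y, x ≤ y → y ∈ U → y ∈ V}
  isClopen' := by
    have h := (S.clopen_down _ (U.isClopen.diff V.isClopen)).1.compl
    convert h using 1
    ext x
    simp only [mem_ofPred_eq, mem_compl_iff, not_exists, not_and, mem_sdiff, SetLike.mem_coe]
    exact ⟨fun h y hy hxy => hy.2 (h y hxy hy.1),
      fun h y hxy hy => by_contra fun hyV => h y ⟨hy, hyV⟩ hxy⟩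
  upper' := fun _ _ hxy hx z hz => hx z (hxy.trans hz)

/-- The algebra of clopen upper sets of an Esakia space. -/
instance instImpAlg (S : HSpa.{u}) : ImpAlg (ClopenUpperSet S.carrier) where
  himp := himp

theorem mem_sup {U V : ClopenUpperSet S.carrier} {x : S.carrier} :
    x ∈ U ⊔ V ↔ x ∈ U ∨ x ∈ V := Iff.rfl

theorem mem_inf {U V : ClopenUpperSet S.carrier} {x : S.carrier} :
    x ∈ U ⊓ V ↔ x ∈ U ∧ x ∈ V := Iff.rfl

theorem mem_himp {U V : ClopenUpperSet S.carrier} {x : S.carrier} :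
    x ∈ U ⇨ V ↔ ∀ y, x ≤ y → y ∈ U → y ∈ V := Iff.rfl

section Indicator

variable (L : Type v) [DistribLattice L] [BoundedOrder L]

open Classical in
/-- The characteristic function of a clopen upper set, with values in `{⊥, ⊤}`. -/
noncomputable def indicator (U : ClopenUpperSet S.carrier) : IntPower L S.carrier where
  val x := if x ∈ U then ⊤ else ⊥
  mono x y hxy := by
    by_cases hx : x ∈ U
    · have hy : y ∈ U := U.upper hxy hx
      simp [hy]
    · simp [hx]

variable {L}

theorem indicator_of_mem {U : ClopenUpperSet S.carrier} {x : S.carrier} (hx : x ∈ U) :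
    (indicator L U).val x = ⊤ := if_pos hx

theorem indicator_of_notMem {U : ClopenUpperSet S.carrier} {x : S.carrier} (hx : x ∉ U) :
    (indicator L U).val x = ⊥ := if_neg hx

theorem indicator_injective [Nontrivial L] :
    Function.Injective (indicator L : ClopenUpperSet S.carrier → _) := by
  intro U V h
  ext x
  have hx : (indicator L U).val x = (indicator L V).val x := by rw [h]
  by_cases hU : x ∈ U <;> by_cases hV : x ∈ V <;>
    simp [indicator, hU, hV] at hx ⊢

end Indicator

variable {L : Type v} [DistribLattice L] [BoundedOrder L] [Finite L]

theorem indicator_sup (U V : ClopenUpperSet S.carrier) :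
    indicator L (U ⊔ V) = indicator L U ⊔ indicator L V := by
  refine IntPower.val_injective (funext fun x => ?_)
  change (indicator L (U ⊔ V)).val x = (indicator L U).val x ⊔ (indicator L V).val x
  by_cases hU : x ∈ U <;> by_cases hV : x ∈ V <;> simp [indicator, mem_sup, hU, hV]

theorem indicator_inf (U V : ClopenUpperSet S.carrier) :
    indicator L (U ⊓ V) = indicator L U ⊓ indicator L V := by
  refine IntPower.val_injective (funext fun x => ?_)
  change (indicator L (U ⊓ V)).val x = (indicator L U).val x ⊓ (indicator L V).val x
  by_cases hU : x ∈ U <;> by_cases hV : x ∈ V <;> simp [indicator, mem_inf, hU, hV]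

/-- Off `U ⇨ V` there is some `y ≥ x` in `U` but not in `V`; its term in the meet is `⊤ → ⊥`, which
is `⊥`. -/
theorem indicator_himp (U V : ClopenUpperSet S.carrier) :
    indicator L (U ⇨ V) = indicator L U ⇨ indicator L V := by
  refine IntPower.val_injective (funext fun x => le_antisymm ?_ ?_)
  · refine (isGLB_finMeet _).2 ?_
    rintro l ⟨y, hxy, rfl⟩
    refine le_finImp_iff.2 ?_
    by_cases hx : x ∈ U ⇨ V
    · by_cases hy : y ∈ U
      · rw [indicator_of_mem (mem_himp.1 hx y hxy hy)]
        exact le_top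
      · rw [indicator_of_notMem hy]
        exact inf_le_left.trans bot_le
    · rw [indicator_of_notMem hx]
      exact inf_le_right.trans bot_le
  · by_cases hx : x ∈ U ⇨ V
    · rw [indicator_of_mem hx]
      exact le_top
    · rw [mem_himp] at hx
      push Not at hx
      obtain ⟨y, hxy, hyU, hyV⟩ := hx
      have h1 : (indicator L U ⇨ indicator L V).val x ≤
          finImp ((indicator L U).val y) ((indicator L V).val y) :=
        (isGLB_finMeet _).1 ⟨y, hxy, rfl⟩
      have h2 := le_finImp_iff.1 h1
      rw [indicator_of_mem hyU, indicator_of_notMem hyV, top_inf_eq] at h2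
      exact h2.trans bot_le

theorem indicator_top : indicator L (⊤ : ClopenUpperSet S.carrier) = ⊤ :=
  IntPower.val_injective (funext fun _ => indicator_of_mem trivial)

theorem indicator_bot : indicator L (⊥ : ClopenUpperSet S.carrier) = ⊥ :=
  IntPower.val_injective (funext fun _ => indicator_of_notMem id)

variable (L S) in
/-- The subalgebra of characteristic functions of clopen upper sets. -/
noncomputable def indicators : ImpSubalg (IntPower L S.carrier) where
  carrier := Set.range (indicator L)
  sup_mem := by
    rintro _ _ ⟨U, rfl⟩ ⟨V, rfl⟩
    exact ⟨U ⊔ V, indicator_sup U V⟩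
  inf_mem := by
    rintro _ _ ⟨U, rfl⟩ ⟨V, rfl⟩
    exact ⟨U ⊓ V, indicator_inf U V⟩
  himp_mem := by
    rintro _ _ ⟨U, rfl⟩ ⟨V, rfl⟩
    exact ⟨U ⇨ V, indicator_himp U V⟩
  top_mem := ⟨⊤, indicator_top⟩
  bot_mem := ⟨⊥, indicator_bot⟩

theorem isISPI_clopenUpperSet [Nontrivial L] (S : HSpa.{u}) :
    IsISPI L (ClopenUpperSet S.carrier) := by
  refine ⟨S.carrier, inferInstance, S.nonempty, indicators S L,
    { toFun := fun U => ⟨indicator L U, U, rfl⟩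
      map_sup := fun U V => Subtype.ext (indicator_sup U V)
      map_inf := fun U V => Subtype.ext (indicator_inf U V)
      map_himp := fun U V => Subtype.ext (indicator_himp U V)
      map_top := Subtype.ext indicator_top
      map_bot := Subtype.ext indicator_bot }, ?_, ?_⟩
  · exact fun U V h => indicator_injective (congrArg Subtype.val h)
  · rintro ⟨_, U, rfl⟩
    exact ⟨U, rfl⟩

/-! ### The functor of clopen upper sets -/

/-- The preimage of a clopen upper set under an Esakia morphism. -/
def preimage (f : EsakiaHom S.carrier T.carrier) (U : ClopenUpperSet T.carrier) :
    ClopenUpperSet S.carrier where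
  carrier := f ⁻¹' U
  isClopen' := U.isClopen.preimage (map_continuous f)
  upper' := fun _ _ hxy hx => U.upper (OrderHomClass.mono f hxy) hx

theorem mem_preimage {f : EsakiaHom S.carrier T.carrier} {U : ClopenUpperSet T.carrier}
    {x : S.carrier} : x ∈ preimage f U ↔ f x ∈ U := Iff.rfl

/-- Taking preimages is a homomorphism of algebras. -/
def preimageHom (f : EsakiaHom S.carrier T.carrier) :
    ImpAlgHom (ClopenUpperSet T.carrier) (ClopenUpperSet S.carrier) where
  toFun := preimage f
  map_sup _ _ := rfl
  map_inf _ _ := rfl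
  map_himp U V := by
    ext x
    simp only [SetLike.mem_coe, mem_preimage, mem_himp]
    refine ⟨fun h y hxy => h _ (OrderHomClass.mono f hxy), fun h z hz => ?_⟩
    obtain ⟨y, hxy, rfl⟩ := EsakiaHomClass.exists_map_eq_of_map_le f hz
    exact h y hxy
  map_top := rfl
  map_bot := rfl

variable (L) in
/-- The contravariant functor of clopen upper sets. -/
def clopenUpperSets [Nontrivial L] : HSpa.{u} ⥤ (ISPI.{u, v} L)ᵒᵖ where
  obj S := Opposite.op ⟨ClopenUpperSet S.carrier, isISPI_clopenUpperSet S⟩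
  map f := Quiver.Hom.op (preimageHom f)
  map_id _ := rfl
  map_comp _ _ := rfl

theorem preimageHom_injective :
    Function.Injective (preimageHom : EsakiaHom S.carrier T.carrier → _) := by
  intro f g h
  have hfg : ∀ x U, f x ∈ U ↔ g x ∈ U := fun x U => by
    rw [← mem_preimage, ← mem_preimage,
      show preimage f U = preimage g U from congrFun (congrArg ImpAlgHom.toFun h) U]
  exact EsakiaHom.ext fun x => le_antisymm
    (PSpa.le_of_forall_clopenUpperSet fun U => (hfg x U).1)
    (PSpa.le_of_forall_clopenUpperSet fun U => (hfg x U).2)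

/-- For each `s`, the sets `U` with `s ∈ h.toFun U` form a prime filter, hence determine a point `f
s`; then `h` is preimage under `f`. -/
theorem preimageHom_surjective :
    Function.Surjective (preimageHom : EsakiaHom S.carrier T.carrier → _) := by
  intro h
  have hpt : ∀ s : S.carrier, ∃ t : T.carrier, ∀ U, t ∈ U ↔ s ∈ h.toFun U := fun s =>
    PSpa.exists_mem_iff (fun U => s ∈ h.toFun U) (by erw [h.map_top]; trivial)
      (by erw [h.map_bot]; exact id) (fun U V => by erw [h.map_inf]; rfl)
      (fun U V => by erw [h.map_sup]; rfl)
  choose f hf using hpt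
  have hcont : Continuous f := PSpa.continuous_of_preimage_clopenUpperSet f fun U => by
    convert (h.toFun U).isClopen using 1
    ext s
    exact hf s U
  have hmono : Monotone f := fun x y hxy => PSpa.le_of_forall_clopenUpperSet fun U hU =>
    (hf y U).2 ((h.toFun U).upper hxy ((hf x U).1 hU))
  refine ⟨⟨⟨⟨f, hmono⟩, hcont⟩, ?_⟩, ?_⟩
  · intro s t hst
    by_contra hn
    have := S.compact
    have := T.toPSpa.t2Space
    -- If `t ≥ f s` misses this closed image, some `U \ V` contains `t` and avoids the image. Then
    -- `s ∈ h.toFun (U ⇨ V)`, so `f s ∈ U ⇨ V`, which forces `t ∈ V`.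
    have hcl : IsClosed (f '' Set.Ici s) :=
      ((PSpa.isClosed_Ici s).isCompact.image hcont).isClosed
    have ht : t ∈ (f '' Set.Ici s)ᶜ := fun ⟨c, hc, hct⟩ => hn ⟨c, hc, hct⟩
    obtain ⟨U, V, hU, hV, hUV⟩ := PSpa.exists_clopenUpperSet_diff_subset hcl.isOpen_compl ht
    have hs : s ∈ h.toFun (U ⇨ V) := by
      rw [h.map_himp, mem_himp]
      intro y hsy hyU
      rw [← hf] at hyU ⊢
      by_contra hyV
      exact hUV _ hyU hyV ⟨y, hsy, rfl⟩
    rw [← hf, mem_himp] at hs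
    exact hV (hs t hst hU)
  · refine ImpAlgHom.ext (funext fun U => ?_)
    ext s
    exact hf s U

instance [Nontrivial L] : (clopenUpperSets.{u} L).Faithful where
  map_injective h := preimageHom_injective (congrArg Quiver.Hom.unop h)

instance [Nontrivial L] : (clopenUpperSets.{u} L).Full where
  map_surjective h := by
    obtain ⟨f, hf⟩ := preimageHom_surjective h.unop
    exact ⟨f, Quiver.Hom.unop_inj hf⟩

end HSpa

/-! ### The prime spectrum of a Heyting algebra -/

/-- The characteristic functions of the prime filters of `A`. -/
def PrimePoint (A : Type u) [HeytingAlgebra A] : Type u :=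
  {p : A → Bool // p ⊤ = true ∧ p ⊥ = false ∧ (∀ a b, p (a ⊓ b) = (p a && p b)) ∧
    ∀ a b, p (a ⊔ b) = (p a || p b)}

namespace PrimePoint

variable {A : Type u} [HeytingAlgebra A]

instance : TopologicalSpace (PrimePoint A) := inferInstanceAs (TopologicalSpace (Subtype _))

instance : PartialOrder (PrimePoint A) := inferInstanceAs (PartialOrder (Subtype _))

/-- The prime filter of a point. -/
def Mem (p : PrimePoint A) (a : A) : Prop := p.1 a = true

theorem mem_top (p : PrimePoint A) : p.Mem ⊤ := p.2.1

theorem not_mem_bot (p : PrimePoint A) : ¬ p.Mem ⊥ := by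
  simp [Mem, p.2.2.1]

theorem mem_inf (p : PrimePoint A) {a b : A} : p.Mem (a ⊓ b) ↔ p.Mem a ∧ p.Mem b := by
  simp [Mem, p.2.2.2.1]

theorem mem_sup (p : PrimePoint A) {a b : A} : p.Mem (a ⊔ b) ↔ p.Mem a ∨ p.Mem b := by
  simp [Mem, p.2.2.2.2]

theorem mem_of_le (p : PrimePoint A) {a b : A} (hab : a ≤ b) (ha : p.Mem a) : p.Mem b := by
  rw [← inf_eq_left.2 hab, mem_inf] at ha
  exact ha.2

theorem le_iff {p q : PrimePoint A} : p ≤ q ↔ ∀ a, p.Mem a → q.Mem a :=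
  forall_congr' fun _ => Bool.le_iff_imp

/-- Each defining condition involves finitely many coordinates, so the spectrum is closed in the
compact cube `A → Bool`. -/
instance : CompactSpace (PrimePoint A) := by
  refine isCompact_iff_compactSpace.1 (IsClosed.isCompact ?_)
  have hc : ∀ a : A, Continuous fun p : A → Bool => p a := continuous_apply
  have h2 : ∀ (f : Bool → Bool → Bool) (a b : A), Continuous fun p : A → Bool => f (p a) (p b) :=
    fun f a b => (continuous_of_discreteTopology (f := fun x : Bool × Bool => f x.1 x.2)).comp
      ((hc a).prodMk (hc b))
  have hall : ∀ P : A → (A → Bool) → Prop, (∀ a, IsClosed {p | P a p}) →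
      IsClosed {p | ∀ a, P a p} := fun P hP => by
    rw [ofPred_forall]
    exact isClosed_iInter hP
  refine (isClosed_eq (hc _) continuous_const).inter
    ((isClosed_eq (hc _) continuous_const).inter (IsClosed.inter (hall _ fun a => hall _ fun b => ?_)
      (hall _ fun a => hall _ fun b => ?_)))
  · exact isClosed_eq (hc _) (h2 and a b)
  · exact isClosed_eq (hc _) (h2 or a b)

/-- The points whose prime filter contains `a`. -/
def basicClopen (a : A) : ClopenUpperSet (PrimePoint A) where
  carrier := {p | p.Mem a}
  isClopen' := (isClopen_discrete {true}).preimage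
    ((continuous_apply a).comp (continuous_subtype_val : Continuous (Subtype.val : PrimePoint A → _)))
  upper' := fun _ _ h => le_iff.1 h a

theorem mem_basicClopen {a : A} {p : PrimePoint A} : p ∈ basicClopen a ↔ p.Mem a := Iff.rfl

/-- The prime ideal theorem separates `F` from the principal ideal of `b`; the complement of the
resulting prime ideal is the required prime filter. -/
theorem exists_of_disjoint (F : Order.PFilter A) (b : A) (hb : b ∉ F) :
    ∃ p : PrimePoint A, (∀ a ∈ F, p.Mem a) ∧ ¬ p.Mem b := by
  classical
  have hd : Disjoint (F : Set A) (Order.Ideal.principal b : Order.Ideal A) :=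
    Set.disjoint_left.2 fun a ha hab => hb (Order.PFilter.mem_of_le hab ha)
  obtain ⟨J, hJ, hIJ, hFJ⟩ := DistribLattice.prime_ideal_of_disjoint_filter_ideal hd
  have hinf : ∀ x y, x ⊓ y ∈ J ↔ x ∈ J ∨ y ∈ J := fun x y =>
    ⟨hJ.mem_or_mem, fun h => h.elim (J.lower inf_le_left) (J.lower inf_le_right)⟩
  refine ⟨⟨fun a => decide (a ∉ J), ?_, ?_, ?_, ?_⟩, ?_, ?_⟩
  · simpa using Order.Ideal.IsProper.top_notMem hJ.toIsProper
  · simp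
  · intro x y
    simp [hinf]
  · intro x y
    simp only [Order.Ideal.sup_mem_iff]
    by_cases hx : x ∈ J <;> by_cases hy : y ∈ J <;> simp [hx, hy]
  · intro a ha
    simpa [Mem] using Set.disjoint_left.1 hFJ ha
  · have : b ∈ J := hIJ (Order.Ideal.mem_principal_self)
    simpa [Mem] using this

theorem exists_not_mem_of_not_le {a b : A} (hab : ¬ a ≤ b) :
    ∃ p : PrimePoint A, p.Mem a ∧ ¬ p.Mem b := by
  obtain ⟨p, hp, hb⟩ := exists_of_disjoint (Order.PFilter.principal a) b hab
  exact ⟨p, hp a le_rfl, hb⟩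

theorem mem_himp_iff (p : PrimePoint A) {a b : A} :
    p.Mem (a ⇨ b) ↔ ∀ q, p ≤ q → q.Mem a → q.Mem b := by
  constructor
  · intro h q hpq ha
    exact q.mem_of_le himp_inf_le (q.mem_inf.2 ⟨le_iff.1 hpq _ h, ha⟩)
  · intro H
    by_contra h
    -- This is the filter generated by `p` and `a`. It omits `b`, so it extends to a prime filter `q
    -- ≥ p` containing `a` but not `b`.
    have hF : Order.IsPFilter {c | p.Mem (a ⇨ c)} := by
      refine Order.IsPFilter.of_def ⟨⊤, ?_⟩ ?_ ?_
      · simpa using p.mem_top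
      · intro x hx y hy
        refine ⟨x ⊓ y, ?_, inf_le_left, inf_le_right⟩
        simp only [mem_ofPred_eq, himp_inf_distrib]
        exact p.mem_inf.2 ⟨hx, hy⟩
      · intro x y hxy hx
        exact p.mem_of_le (himp_le_himp_left hxy) hx
    obtain ⟨q, hq, hb⟩ := exists_of_disjoint hF.toPFilter b h
    refine hb (H q (le_iff.2 fun c hc => hq c ?_) (hq a ?_))
    · exact p.mem_of_le le_himp hc
    · change p.Mem (a ⇨ a)
      simpa using p.mem_top

variable (A)

theorem separated (x y : PrimePoint A) (hxy : ¬ x ≤ y) : ∃ a, x ∈ basicClopen a ∧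
    y ∉ basicClopen a := by
  rw [le_iff] at hxy
  push Not at hxy
  exact hxy

/-- The prime spectrum as a compact totally order-separated space. -/
def toPSpa [Nontrivial A] : PSpa.{u} where
  carrier := PrimePoint A
  nonempty := (exists_not_mem_of_not_le (A := A) (a := ⊤) (b := ⊥) (by simp)).nonempty
  compact := inferInstance
  separated x y hxy := by
    obtain ⟨a, hx, hy⟩ := PrimePoint.separated A x y hxy
    exact ⟨_, (basicClopen a).isClopen, (basicClopen a).upper, hx, hy⟩

theorem basicClopen_surjective [Nontrivial A] :
    Function.Surjective (basicClopen : A → ClopenUpperSet (PrimePoint A)) :=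
  PSpa.surjective_of_separates (S := toPSpa A) basicClopen
    (ClopenUpperSet.ext (Set.ext fun p => iff_of_true p.mem_top trivial))
    (ClopenUpperSet.ext (Set.ext fun p => iff_of_false p.not_mem_bot id))
    (fun _ _ => ClopenUpperSet.ext (Set.ext fun p => p.mem_inf))
    (fun _ _ => ClopenUpperSet.ext (Set.ext fun p => p.mem_sup))
    (PrimePoint.separated A)

/-- The prime spectrum as an Esakia space. -/
def toHSpa [Nontrivial A] : HSpa.{u} where
  toPSpa := toPSpa A
  clopen_down O hO := by
    refine ⟨PSpa.isClopen_down_of_diff (S := toPSpa A) (fun U V => ?_) hO,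
      fun x y hyx ⟨z, hz, hxz⟩ => ⟨z, hz, hyx.trans hxz⟩⟩
    obtain ⟨a, rfl⟩ := basicClopen_surjective A U
    obtain ⟨b, rfl⟩ := basicClopen_surjective A V
    -- The down-closure of the difference is the complement of the basic clopen set of `a ⇨ b`.
    refine (congrArg IsClopen (Set.ext fun (p : PrimePoint A) => ?_)).mpr
      (basicClopen (a ⇨ b)).isClopen.compl
    change (∃ q : PrimePoint A, (q.Mem a ∧ ¬ q.Mem b) ∧ p ≤ q) ↔ ¬ p.Mem (a ⇨ b)
    rw [mem_himp_iff]
    push Not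
    exact ⟨fun ⟨q, hq, hpq⟩ => ⟨q, hpq, hq⟩, fun ⟨q, hpq, hq⟩ => ⟨q, hq, hpq⟩⟩

theorem basicClopen_injective :
    Function.Injective (basicClopen : A → ClopenUpperSet (PrimePoint A)) := by
  have key : ∀ a b : A, basicClopen a = basicClopen b → a ≤ b := by
    intro a b h
    by_contra hab
    obtain ⟨p, ha, hb⟩ := exists_not_mem_of_not_le hab
    rw [← mem_basicClopen, ← h] at hb
    exact hb ha
  exact fun a b h => le_antisymm (key a b h) (key b a h.symm)

/-- The representation of a Heyting algebra by the clopen upper sets of its prime spectrum. -/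
def basicClopenHom [Nontrivial A] :
    @ImpAlgHom A (ClopenUpperSet (toHSpa A).carrier) (HeytingAlgebra.toImpAlg ‹_›) _ :=
  letI : ImpAlg A := HeytingAlgebra.toImpAlg ‹_›
  { toFun := basicClopen
    map_sup := fun _ _ => ClopenUpperSet.ext (Set.ext fun p => PrimePoint.mem_sup p)
    map_inf := fun _ _ => ClopenUpperSet.ext (Set.ext fun p => PrimePoint.mem_inf p)
    map_himp := fun _ _ => ClopenUpperSet.ext (Set.ext fun p => PrimePoint.mem_himp_iff p)
    map_top := ClopenUpperSet.ext (Set.ext fun p => iff_of_true (PrimePoint.mem_top p) trivial)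
    map_bot := ClopenUpperSet.ext (Set.ext fun p => iff_of_false (PrimePoint.not_mem_bot p) id) }

end PrimePoint

/-! ### The duality -/

/-- A bijective homomorphism is an isomorphism in `ISP_I(L)`. -/
noncomputable def ISPI.isoOfBijective {L : Type v} [DistribLattice L] [BoundedOrder L] [Finite L]
    {A B : ISPI.{u, v} L} (f : ImpAlgHom A.carrier B.carrier) (hf : Function.Bijective f.toFun) :
    A ≅ B :=
  let e := Equiv.ofBijective f.toFun hf
  have he : ∀ b, f.toFun (e.symm b) = b := e.apply_symm_apply
  { hom := f
    inv :=
      { toFun := e.symm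
        map_sup := fun a b => hf.1 (by simp only [f.map_sup, he])
        map_inf := fun a b => hf.1 (by simp only [f.map_inf, he])
        map_himp := fun a b => hf.1 (by simp only [f.map_himp, he])
        map_top := hf.1 (by simp only [f.map_top, he])
        map_bot := hf.1 (by simp only [f.map_bot, he]) }
    hom_inv_id := ImpAlgHom.ext (funext e.symm_apply_apply)
    inv_hom_id := ImpAlgHom.ext (funext he) }

instance {L : Type v} [DistribLattice L] [BoundedOrder L] [Finite L] [Nontrivial L] :
    (HSpa.clopenUpperSets.{u} L).EssSurj where
  mem_essImage Y := by
    obtain ⟨A, hA⟩ := Y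
    -- Substituting the given operations by those of `h` makes the representation map an arrow of
    -- `ISP_I(L)`.
    obtain ⟨h, rfl, hnt⟩ := hA.exists_heytingAlgebra
    exact ⟨PrimePoint.toHSpa A, ⟨(ISPI.isoOfBijective (A := @ISPI.mk L _ _ _ A h.toImpAlg hA)
      (B := ⟨ClopenUpperSet (PrimePoint.toHSpa A).carrier, HSpa.isISPI_clopenUpperSet _⟩)
      (PrimePoint.basicClopenHom A)
      ⟨PrimePoint.basicClopen_injective A, PrimePoint.basicClopen_surjective A⟩).op⟩⟩

theorem theoremD22 (L : Type v) [DistribLattice L] [BoundedOrder L] [Finite L] [Nontrivial L] :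
    Nonempty ((ISPI.{u, v} L)ᵒᵖ ≌ HSpa.{u}) := by
  have : (HSpa.clopenUpperSets.{u} L).IsEquivalence := {}
  exact ⟨(HSpa.clopenUpperSets.{u} L).asEquivalence.symm⟩
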